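/- Let $\mathbb K$ be a field of characteristic zero, let $\gamma\ge 0$ be an integer and $[\gamma]=\{1,\dots,\gamma\}$. Let $\mathsf{Dias}_\gamma$ be the suboperad, generated by the words $\dashv_a\,:=0a$ and $\vdash_a\,:=a0$ ($a\in[\gamma]$), of the nonsymmetric operad over $\mathbb K$ whose arity $n$ component has as basis the words of length $n$ on $\{0,\dots,\gamma\}$ and where $u\circ_i v$ is obtained by replacing the $i$-th letter $u_i$ of $u$ by $\max(u_i,v_1)\cdots\max(u_i,v_m)$. Let $\mathsf{Dendr}_\gamma$ be its Koszul dual, i.e. the quotient of the free nonsymmetric operad on binary generators $\leftharpoonup_a,\rightharpoonup_a$ ($a\in[\gamma]$, corresponding to $\dashv_a,\vdash_a$) by the operadic ideal generated by the annihilator of the space of arity-three relations of $\mathsf{Dias}_\gamma$, for the scalar product in which distinct syntax trees $x\circ_i y$ are orthogonal, $\langle x\circ_1 y,x\circ_1 y\rangle=1$ and $\langle x\circ_2 y,x\circ_2 y\rangle=-1$. Let $\pi$ be the canonical surjection from the free operad onto $\mathsf{Dendr}_\gamma$. For $b\in[\gamma]$ put $\prec_b:=\sum_{a\le b}\leftharpoonup_a$,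 $\succ_b:=\sum_{a\le b}\rightharpoonup_a$ and $\odot_b:=\pi(\prec_b+\succ_b)$. An element $x\in\mathsf{Dendr}_\gamma(2)$ is called associative if $x\circ_1x=x\circ_2x$. Then: 1. for every $b\in[\gamma]$, $\odot_b=\pi\bigl(\sum_{a\le b}(\leftharpoonup_a+\rightharpoonup_a)\bigr)$, and $\odot_b$ is associative; 2. conversely, for every associative element $x\in\mathsf{Dendr}_\gamma(2)$ such that $\gamma\ge1$ or $x\ne0$, there are $b\in[\gamma]$ and $c\in\mathbb K$ with $x=c\,\odot_b$. -/

import Mathlib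

/-! Nonsymmetric operads in `K`-vector spaces: free operads on binary generators, operadic ideals,
quotients, Koszul duals of binary quadratic operads, and the polydendriform operads. -/

namespace PolyDendr

/-- `graft t i s` replaces the leaf number `i` of `t` by `s`; leaves are counted from the left,
starting from `0`. -/
def graft {G : Type} : BinaryTree G → ℕ → BinaryTree G → BinaryTree G
  | .nil, _, s => s
  | .node g l r, i, s =>
      if i < l.numLeaves then .node g (graft l i s) r
      else .node g l (graft r (i - l.numLeaves) s)

theorem numLeaves_graft {G : Type} (t : BinaryTree G) (i : ℕ) (s : BinaryTree G)
    (hi : i < t.numLeaves) :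
    (graft t i s).numLeaves = t.numLeaves + s.numLeaves - 1 := by
  induction t generalizing i with
  | nil => simp [graft]
  | node g l r hl hr =>
    simp only [graft, BinaryTree.numLeaves] at hi ⊢
    split_ifs with h
    · have := hl i h
      simp only [BinaryTree.numLeaves]
      omega
    · have := hr (i - l.numLeaves) (by omega)
      simp only [BinaryTree.numLeaves]
      omega

/-- Syntax trees of arity `n` on the set `G` of binary generators: binary trees with `n` leaves
whose internal nodes are labelled by elements of `G`. -/
def STree (G : Type) (n : ℕ) : Type := {t : BinaryTree G // t.numLeaves = n}

/-- Partial composition of syntax trees. The index `i : Fin n` is `0`-based: this is the operation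
usually written `∘_{i+1}`. -/
def STree.comp {G : Type} {n m : ℕ} (i : Fin n) (t : STree G n) (s : STree G m) :
    STree G (n + m - 1) :=
  ⟨graft t.1 i s.1, by
    rw [numLeaves_graft t.1 i s.1 (by rw [t.2]; exact i.2), t.2, s.2]⟩

/-- The arity `n` component of the free nonsymmetric operad generated by the set `G` of
generators, all of arity two: the vector space with basis the syntax trees of arity `n`. -/
abbrev Free (K : Type*) [Field K] (G : Type) (n : ℕ) : Type _ := STree G n →₀ K

/-- Partial composition of the free operad: the bilinear extension of `STree.comp`. -/
noncomputable def Free.comp (K : Type*) [Field K] (G : Type) {n m : ℕ} (i : Fin n) :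
    Free K G n →ₗ[K] Free K G m →ₗ[K] Free K G (n + m - 1) :=
  Finsupp.linearCombination K fun t : STree G n =>
    Finsupp.lmapDomain K K fun s : STree G m => STree.comp i t s

/-- The generator `g`, seen as an element of arity two of the free operad. -/
noncomputable def Free.gen (K : Type*) [Field K] {G : Type} (g : G) : Free K G 2 :=
  Finsupp.single ⟨.node g .nil .nil, rfl⟩ 1

/-- An operadic ideal of the free operad: a family of subspaces which is stable under partial
composition with arbitrary elements, on both sides. -/
def IsOperadIdeal {K : Type*} [Field K] {G : Type} (I : ∀ n, Submodule K (Free K G n)) : Prop :=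
  ∀ (n m : ℕ) (i : Fin n) (x : Free K G n) (y : Free K G m),
    (x ∈ I n ∨ y ∈ I m) → Free.comp K G i x y ∈ I (n + m - 1)

/-- The operadic ideal generated by a space `R` of elements of arity three: the intersection of
all the operadic ideals that contain `R`. -/
noncomputable def ideal {K : Type*} [Field K] {G : Type} (R : Submodule K (Free K G 3)) (n : ℕ) :
    Submodule K (Free K G n) :=
  ⨅ (I : ∀ k, Submodule K (Free K G k)) (_ : IsOperadIdeal I ∧ R ≤ I 3), I n

theorem ideal_isOperadIdeal {K : Type*} [Field K] {G : Type} (R : Submodule K (Free K G 3)) :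
    IsOperadIdeal (ideal R) := by
  intro n m i x y h
  simp only [ideal, Submodule.mem_iInf] at h ⊢
  intro I hI
  exact hI.1 n m i x y (h.imp (fun h => h I hI) (fun h => h I hI))

/-- The arity `n` component of the binary quadratic operad with presentation `(G, R)`: the quotient
of the free operad on `G` by the operadic ideal generated by `R`. -/
abbrev Presented (K : Type*) [Field K] (G : Type) (R : Submodule K (Free K G 3)) (n : ℕ) :
    Type _ :=
  Free K G n ⧸ ideal R n

/-- The canonical surjection from the free operad onto the operad with presentation `(G, R)`. -/
noncomputable def Presented.proj {K : Type*} [Field K] {G : Type} (R : Submodule K (Free K G 3)) (n : ℕ) :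
    Free K G n →ₗ[K] Presented K G R n :=
  (ideal R n).mkQ

/-- Partial composition of the operad with presentation `(G, R)`, induced by the one of the free
operad. -/
noncomputable def Presented.comp {K : Type*} [Field K] {G : Type} (R : Submodule K (Free K G 3))
    {n m : ℕ} (i : Fin n) :
    Presented K G R n →ₗ[K] Presented K G R m →ₗ[K] Presented K G R (n + m - 1) :=
  (ideal R n).liftQ
    (LinearMap.mk₂ K
      (fun (x : Free K G n) (y : Presented K G R m) =>
        (ideal R m).mapQ (ideal R (n + m - 1)) (Free.comp K G i x)
          (fun z hz => ideal_isOperadIdeal R n m i x z (Or.inr hz)) y)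
      (fun x x' y => by
        obtain ⟨y, rfl⟩ := (ideal R m).mkQ_surjective y
        simp)
      (fun c x y => by
        obtain ⟨y, rfl⟩ := (ideal R m).mkQ_surjective y
        simp)
      (fun x y y' => by simp)
      (fun c x y => by simp))
    (fun x hx => by
      rw [LinearMap.mem_ker]
      ext y
      simpa using ideal_isOperadIdeal R n m i x (Finsupp.single y 1) (Or.inl hx))

theorem Presented.comp_proj {K : Type*} [Field K] {G : Type} (R : Submodule K (Free K G 3))
    {n m : ℕ} (i : Fin n) (x : Free K G n) (y : Free K G m) :
    Presented.comp R i (Presented.proj R n x) (Presented.proj R m y) =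
      Presented.proj R (n + m - 1) (Free.comp K G i x y) := rfl

/-- An element `x` of arity two is associative when `x ∘₁ x = x ∘₂ x`. -/
def IsAssociative {K : Type*} [Field K] {G : Type} {R : Submodule K (Free K G 3)}
    (x : Presented K G R 2) : Prop :=
  Presented.comp R (0 : Fin 2) x x = Presented.comp R (1 : Fin 2) x x

/-- The sign of a syntax tree of arity three in the scalar product used for Koszul duality:
`1` for `g ∘₁ h` and `-1` for `g ∘₂ h`. -/
def sign {G : Type} : BinaryTree G → ℤ
  | .node _ (.node _ _ _) _ => 1
  | _ => -1

/-- The scalar product on the arity three component of the free operad: distinct syntax trees are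
orthogonal, `⟨g ∘₁ h, g ∘₁ h⟩ = 1` and `⟨g ∘₂ h, g ∘₂ h⟩ = -1`. -/
noncomputable def pairing (K : Type*) [Field K] (G : Type) :
    Free K G 3 →ₗ[K] Free K G 3 →ₗ[K] K :=
  Finsupp.linearCombination K fun t : STree G 3 => ((sign t.1 : ℤ) : K) • Finsupp.lapply t

/-- The annihilator of a space of relations with respect to the scalar product. -/
noncomputable def annihilator {K : Type*} [Field K] {G : Type} (R : Submodule K (Free K G 3)) :
    Submodule K (Free K G 3) :=
  R.orthogonalBilin (pairing K G)

/-- The Koszul dual of the binary quadratic operad with presentation `(G, R)`: the operad with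
presentation `(G, annihilator R)`. -/
abbrev KoszulDual (K : Type*) [Field K] (G : Type) (R : Submodule K (Free K G 3)) (n : ℕ) :
    Type _ :=
  Presented K G (annihilator R) n

/-- The set `{1, …, γ}`. -/
abbrev Idx (γ : ℕ) : Type := {a : ℕ // a ∈ Finset.Icc 1 γ}

/-- The `2γ` binary generators. In `Dias_γ`, `lft a` is `⊣_a` and `rgt a` is `⊢_a`; in the Koszul
dual `Dendr_γ`, `lft a` is `↼_a` and `rgt a` is `⇀_a`. -/
inductive Gen (γ : ℕ) : Type
  | lft (a : Idx γ)
  | rgt (a : Idx γ)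

/-- The word of length two that realizes a generator of `Dias_γ`: `⊣_a` is `0a` and `⊢_a` is
`a0`. -/
def Gen.word {γ : ℕ} : Gen γ → ℕ × ℕ
  | .lft a => (0, a)
  | .rgt a => (a, 0)

/-- The value of a syntax tree in the operad of words on the monoid `({0, …, γ}, max)`, where
`u ∘_i v` is obtained from `u` by replacing its `i`-th letter `u_i` by the word
`max(u_i, v_1) … max(u_i, v_m)`. The unit is the word `0`, and a tree with root `g = g₁g₂` and
subtrees of values `u`, `v` has value `(g ∘₂ v) ∘₁ u`. The operad `Dias_γ` is the suboperad
generated by the words `0a` and `a0` for `a ∈ {1, …, γ}`. -/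
def evalWord {γ : ℕ} : BinaryTree (Gen γ) → List ℕ
  | .nil => [0]
  | .node g l r => (evalWord l).map (max g.word.1) ++ (evalWord r).map (max g.word.2)

/-- The space of relations of the `γ`-pluriassociative operad `Dias_γ`: the linear combinations of
syntax trees of arity three on its generators whose value in `Dias_γ` is zero. -/
noncomputable def diasRel (K : Type*) [Field K] (γ : ℕ) : Submodule K (Free K (Gen γ) 3) :=
  LinearMap.ker (Finsupp.lmapDomain K K fun t : STree (Gen γ) 3 => evalWord t.1)

/-- The `γ`-polydendriform operad `Dendr_γ`, the Koszul dual of `Dias_γ` (component of arity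
`n`). -/
abbrev Dendr (K : Type*) [Field K] (γ n : ℕ) : Type _ := KoszulDual K (Gen γ) (diasRel K γ) n

/-- The canonical surjection from the free operad on the `↼_a`, `⇀_a` onto `Dendr_γ`. -/
noncomputable def dendrProj (K : Type*) [Field K] (γ n : ℕ) :
    Free K (Gen γ) n →ₗ[K] Dendr K γ n :=
  Presented.proj (annihilator (diasRel K γ)) n

/-- `≺_b`, the sum of the `↼_a` for `a ≤ b`, in the free operad. -/
noncomputable def precOp (K : Type*) [Field K] {γ : ℕ} (b : Idx γ) : Free K (Gen γ) 2 :=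
  ∑ a : Idx γ with a ≤ b, Free.gen K (Gen.lft a)

/-- `≻_b`, the sum of the `⇀_a` for `a ≤ b`, in the free operad. -/
noncomputable def succOp (K : Type*) [Field K] {γ : ℕ} (b : Idx γ) : Free K (Gen γ) 2 :=
  ∑ a : Idx γ with a ≤ b, Free.gen K (Gen.rgt a)

/-- `⊙_b`, the image of `≺_b + ≻_b` in `Dendr_γ`. -/
noncomputable def odot (K : Type*) [Field K] {γ : ℕ} (b : Idx γ) : Dendr K γ 2 :=
  dendrProj K γ 2 (precOp K b + succOp K b)

end PolyDendr

/-! The ideal generated by a space `R` of elements of arity three is `R` itself in arity three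
(`ideal_three`), so associativity of the image of `X = ∑ (λ_a ↼_a + μ_a ⇀_a)` means that
`X ∘₁ X - X ∘₂ X` annihilates the relations of `Dias_γ`. These relations are spanned by the
differences of two trees of the same word, and the sign in the scalar product compensates the sign
in `X ∘₁ X - X ∘₂ X`. The condition is therefore that the product `X_g X_h` of the coefficients of
the two labels of a tree of arity three depends only on the word of the tree.

For `≺_b + ≻_b` this product is `1` or `0` according to whether all letters of the word are at most
`b`, hence associativity. Conversely, the trees with words `0aa` and `aa0` show that
`λ_a ≠ 0` or `μ_a ≠ 0` forces `λ_d = μ_d = λ_a = μ_a` for all `d ≤ a`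
(`coeff_eq_of_coeff_ne_zero`). The largest `a` with a nonzero coefficient then gives
`X = c (≺_a + ≻_a)`. -/

namespace PolyDendr

/-! ### Syntax trees of small arity -/

section Trees

variable {G : Type}

/-- The syntax tree without internal node, which is the unit of the operad of syntax trees. -/
def STree.leaf : STree G 1 := ⟨.nil, rfl⟩

/-- The syntax tree of arity two with label `g`. -/
def STree.corolla (g : G) : STree G 2 := ⟨.node g .nil .nil, rfl⟩

/-- The syntax tree `g ∘₁ h`. -/
def STree.leftComb (g h : G) : STree G 3 := ⟨.node g (.node h .nil .nil) .nil, rfl⟩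

/-- The syntax tree `g ∘₂ h`. -/
def STree.rightComb (g h : G) : STree G 3 := ⟨.node g .nil (.node h .nil .nil), rfl⟩

theorem numLeaves_eq_one {t : BinaryTree G} (ht : t.numLeaves = 1) : t = .nil := by
  cases t with
  | nil => rfl
  | node g l r =>
    have hl := l.numLeaves_pos
    have hr := r.numLeaves_pos
    simp only [BinaryTree.numLeaves] at ht
    omega

theorem numLeaves_eq_two {t : BinaryTree G} (ht : t.numLeaves = 2) :
    ∃ g, t = .node g .nil .nil := by
  cases t with
  | nil => simp [BinaryTree.numLeaves] at ht
  | node g l r =>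
    have hl := l.numLeaves_pos
    have hr := r.numLeaves_pos
    simp only [BinaryTree.numLeaves] at ht
    rw [numLeaves_eq_one (t := l) (by omega), numLeaves_eq_one (t := r) (by omega)]
    exact ⟨g, rfl⟩

theorem STree.eq_corolla (t : STree G 2) : ∃ g, t = corolla g := by
  obtain ⟨g, hg⟩ := numLeaves_eq_two t.2
  exact ⟨g, Subtype.ext hg⟩

theorem STree.eq_leftComb_or_rightComb (t : STree G 3) :
    ∃ g h, t = leftComb g h ∨ t = rightComb g h := by
  obtain ⟨t, ht⟩ := t
  cases t with
  | nil => simp [BinaryTree.numLeaves] at ht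
  | node g l r =>
    have hl := l.numLeaves_pos
    have hr := r.numLeaves_pos
    have ht' := ht
    simp only [BinaryTree.numLeaves] at ht'
    obtain h1 | h1 : l.numLeaves = 1 ∨ r.numLeaves = 1 := by omega
    · obtain ⟨h, rfl⟩ := numLeaves_eq_two (t := r) (by omega)
      obtain rfl := numLeaves_eq_one h1
      exact ⟨g, h, Or.inr rfl⟩
    · obtain ⟨h, rfl⟩ := numLeaves_eq_two (t := l) (by omega)
      obtain rfl := numLeaves_eq_one h1
      exact ⟨g, h, Or.inl rfl⟩

theorem STree.corolla_inj {g g' : G} : corolla g = corolla g' ↔ g = g' :=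
  ⟨fun e => by simpa [corolla] using congrArg Subtype.val e, fun e => e ▸ rfl⟩

theorem STree.leftComb_inj {g h g' h' : G} :
    leftComb g h = leftComb g' h' ↔ g = g' ∧ h = h' :=
  ⟨fun e => by simpa [leftComb] using congrArg Subtype.val e, fun e => e.1 ▸ e.2 ▸ rfl⟩

theorem STree.rightComb_inj {g h g' h' : G} :
    rightComb g h = rightComb g' h' ↔ g = g' ∧ h = h' :=
  ⟨fun e => by simpa [rightComb] using congrArg Subtype.val e, fun e => e.1 ▸ e.2 ▸ rfl⟩

theorem STree.leftComb_ne_rightComb (g h g' h' : G) : leftComb g h ≠ rightComb g' h' :=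
  fun e => by simpa [leftComb, rightComb] using congrArg Subtype.val e

instance : IsEmpty (STree G 0) :=
  ⟨fun t => absurd t.2 t.1.numLeaves_pos.ne'⟩

theorem graft_nil (t : BinaryTree G) (i : ℕ) : graft t i .nil = t := by
  induction t generalizing i with
  | nil => rfl
  | node g l r hl hr => simp only [graft, hl, hr, ite_self]

end Trees

/-! ### Partial compositions in the free operad -/

section Free

variable {K : Type*} [Field K] {G : Type}

theorem Free.comp_single {n m : ℕ} (i : Fin n) (t : STree G n) (s : STree G m) (a b : K) :
    Free.comp K G i (Finsupp.single t a) (Finsupp.single s b) =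
      Finsupp.single (STree.comp i t s) (a * b) := by
  simp [Free.comp, Finsupp.lmapDomain_apply, Finsupp.mapDomain_single]

/-- The associator `x ∘₁ x - x ∘₂ x` of an element of arity two of the free operad. -/
noncomputable def Free.associator (x : Free K G 2) : Free K G 3 :=
  Free.comp K G (0 : Fin 2) x x - Free.comp K G (1 : Fin 2) x x

theorem Free.comp_zero_apply (x y : Free K G 2) (g h : G) :
    (Free.comp K G (0 : Fin 2) x y : Free K G 3) (.leftComb g h) =
        x (.corolla g) * y (.corolla h) ∧
      (Free.comp K G (0 : Fin 2) x y : Free K G 3) (.rightComb g h) = 0 := by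
  classical
  induction x using Finsupp.induction_linear with
  | zero => simp
  | add x x' hx hx' =>
    simp only [map_add, LinearMap.add_apply]
    exact ⟨(congrArg₂ (· + ·) hx.1 hx'.1).trans (add_mul _ _ _).symm,
      (congrArg₂ (· + ·) hx.2 hx'.2).trans (add_zero _)⟩
  | single t a =>
    induction y using Finsupp.induction_linear with
    | zero => simp
    | add y y' hy hy' =>
      simp only [map_add]
      exact ⟨(congrArg₂ (· + ·) hy.1 hy'.1).trans (mul_add _ _ _).symm,
        (congrArg₂ (· + ·) hy.2 hy'.2).trans (add_zero _)⟩
    | single s b =>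
      obtain ⟨g', rfl⟩ := t.eq_corolla
      obtain ⟨h', rfl⟩ := s.eq_corolla
      rw [Free.comp_single]
      change (Finsupp.single (STree.leftComb g' h') (a * b) : Free K G 3) _ = _ ∧
        (Finsupp.single (STree.leftComb g' h') (a * b) : Free K G 3) _ = 0
      simp only [Finsupp.single_apply, STree.corolla_inj, STree.leftComb_inj,
        STree.leftComb_ne_rightComb, if_false, and_true]
      split_ifs <;> simp_all

theorem Free.comp_one_apply (x y : Free K G 2) (g h : G) :
    (Free.comp K G (1 : Fin 2) x y : Free K G 3) (.leftComb g h) = 0 ∧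
      (Free.comp K G (1 : Fin 2) x y : Free K G 3) (.rightComb g h) =
        x (.corolla g) * y (.corolla h) := by
  classical
  induction x using Finsupp.induction_linear with
  | zero => simp
  | add x x' hx hx' =>
    simp only [map_add, LinearMap.add_apply]
    exact ⟨(congrArg₂ (· + ·) hx.1 hx'.1).trans (add_zero _),
      (congrArg₂ (· + ·) hx.2 hx'.2).trans (add_mul _ _ _).symm⟩
  | single t a =>
    induction y using Finsupp.induction_linear with
    | zero => simp
    | add y y' hy hy' =>
      simp only [map_add]
      exact ⟨(congrArg₂ (· + ·) hy.1 hy'.1).trans (add_zero _),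
        (congrArg₂ (· + ·) hy.2 hy'.2).trans (mul_add _ _ _).symm⟩
    | single s b =>
      obtain ⟨g', rfl⟩ := t.eq_corolla
      obtain ⟨h', rfl⟩ := s.eq_corolla
      rw [Free.comp_single]
      change (Finsupp.single (STree.rightComb g' h') (a * b) : Free K G 3) _ = 0 ∧
        (Finsupp.single (STree.rightComb g' h') (a * b) : Free K G 3) _ = _
      simp only [Finsupp.single_apply, STree.corolla_inj, STree.rightComb_inj,
        (STree.leftComb_ne_rightComb _ _ _ _).symm, if_false, true_and]
      split_ifs <;> simp_all

theorem Free.associator_leftComb (x : Free K G 2) (g h : G) :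
    associator x (.leftComb g h) = x (.corolla g) * x (.corolla h) :=
  (congrArg₂ (· - ·) (comp_zero_apply x x g h).1 (comp_one_apply x x g h).1).trans (sub_zero _)

theorem Free.associator_rightComb (x : Free K G 2) (g h : G) :
    associator x (.rightComb g h) = -(x (.corolla g) * x (.corolla h)) :=
  (congrArg₂ (· - ·) (comp_zero_apply x x g h).2 (comp_one_apply x x g h).2).trans (zero_sub _)

/-! ### Operadic ideals generated in arity three -/

theorem le_ideal_three (R : Submodule K (Free K G 3)) : R ≤ ideal R 3 :=
  le_iInf₂ fun _ hI => hI.2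

theorem Free.comp_one_three (i : Fin 1) (x : Free K G 1) (y : Free K G 3) :
    (Free.comp K G i x y : Free K G 3) = x .leaf • y := by
  induction x using Finsupp.induction_linear with
  | zero => rw [map_zero, Finsupp.zero_apply, zero_smul]; rfl
  | add x x' hx hx' =>
    rw [map_add, LinearMap.add_apply, Finsupp.add_apply, add_smul, ← hx, ← hx']
  | single t a =>
    obtain rfl : t = .leaf := Subtype.ext (numLeaves_eq_one t.2)
    rw [Finsupp.single_eq_same]
    induction y using Finsupp.induction_linear with
    | zero => simp
    | add y y' hy hy' => rw [map_add, smul_add, ← hy, ← hy']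
    | single s b =>
      rw [Free.comp_single, Finsupp.smul_single, smul_eq_mul]
      exact congrArg (fun u : STree G 3 => (Finsupp.single u (a * b) : Free K G 3))
        (Subtype.ext rfl)

theorem Free.comp_three_one (i : Fin 3) (x : Free K G 3) (y : Free K G 1) :
    (Free.comp K G i x y : Free K G 3) = y .leaf • x := by
  induction y using Finsupp.induction_linear with
  | zero => simp
  | add y y' hy hy' => rw [map_add, Finsupp.add_apply, add_smul, ← hy, ← hy']
  | single s b =>
    obtain rfl : s = .leaf := Subtype.ext (numLeaves_eq_one s.2)
    rw [Finsupp.single_eq_same]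
    induction x using Finsupp.induction_linear with
    | zero => simp
    | add x x' hx hx' => rw [map_add, LinearMap.add_apply, smul_add, ← hx, ← hx']
    | single t a =>
      rw [Free.comp_single, Finsupp.smul_single, smul_eq_mul, mul_comm b a]
      exact congrArg (fun u : STree G 3 => (Finsupp.single u (a * b) : Free K G 3))
        (Subtype.ext (graft_nil t.1 i))

/-- The family of subspaces that is zero below arity three, `R` in arity three and everything
above arity three. -/
noncomputable def truncIdeal (R : Submodule K (Free K G 3)) : ∀ n, Submodule K (Free K G n)
  | 0 | 1 | 2 => ⊥
  | 3 => R
  | _ + 4 => ⊤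

theorem truncIdeal_of_lt (R : Submodule K (Free K G 3)) {n : ℕ} (hn : n < 3) :
    truncIdeal R n = ⊥ := by
  interval_cases n <;> rfl

theorem truncIdeal_of_gt (R : Submodule K (Free K G 3)) {n : ℕ} (hn : 3 < n) :
    truncIdeal R n = ⊤ := by
  obtain ⟨k, rfl⟩ := Nat.exists_eq_add_of_le' hn
  rfl

theorem truncIdeal_isOperadIdeal (R : Submodule K (Free K G 3)) :
    IsOperadIdeal (truncIdeal R) := by
  intro n m i x y hxy
  have hn := i.pos
  obtain hlarge | hsmall := Nat.lt_or_ge 3 (n + m - 1)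
  · rw [truncIdeal_of_gt R hlarge]
    trivial
  -- There are no trees of arity zero, so the truncated subtraction at `m = 0` is harmless.
  obtain rfl | hm := m.eq_zero_or_pos
  · rw [Subsingleton.elim y 0, map_zero]
    exact zero_mem _
  obtain hx | hy := hxy
  · obtain hn3 | hn3 := Nat.lt_or_ge n 3
    · rw [truncIdeal_of_lt R hn3, Submodule.mem_bot] at hx
      rw [hx, map_zero, LinearMap.zero_apply]
      exact zero_mem _
    · obtain rfl : n = 3 := by omega
      obtain rfl : m = 1 := by omega
      exact (Free.comp_three_one i x y).symm ▸ R.smul_mem _ hx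
  · obtain hm3 | hm3 := Nat.lt_or_ge m 3
    · rw [truncIdeal_of_lt R hm3, Submodule.mem_bot] at hy
      rw [hy, map_zero]
      exact zero_mem _
    · obtain rfl : m = 3 := by omega
      obtain rfl : n = 1 := by omega
      exact (Free.comp_one_three i x y).symm ▸ R.smul_mem _ hy

/-- An operadic ideal generated in arity three has no other elements of arity three. -/
theorem ideal_three (R : Submodule K (Free K G 3)) : ideal R 3 = R :=
  le_antisymm (iInf₂_le (truncIdeal R) ⟨truncIdeal_isOperadIdeal R, le_rfl⟩) (le_ideal_three R)

theorem isAssociative_proj_iff {R : Submodule K (Free K G 3)} (x : Free K G 2) :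
    IsAssociative (Presented.proj R 2 x) ↔ Free.associator x ∈ R := by
  rw [IsAssociative, Presented.comp_proj, Presented.comp_proj]
  conv_rhs => rw [← ideal_three R]
  exact Submodule.Quotient.eq (ideal R 3)

end Free

/-! ### Annihilator of the relations of `Dias_γ` -/

section Dias

variable {K : Type*} [Field K] {γ : ℕ}

theorem pairing_single {G : Type} (t : STree G 3) (a : K) (y : Free K G 3) :
    pairing K G (Finsupp.single t a) y = a * ((sign t.1 : ℤ) * y t) := by
  simp [pairing]

/-- The easy half of the description of the annihilator: up to sign, its elements are the functions
on trees that factor through the word of the tree. -/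
theorem mem_annihilator_of_factors {y : Free K (Gen γ) 3} (F : List ℕ → K)
    (hF : ∀ t, ((sign t.1 : ℤ) : K) * y t = F (evalWord t.1)) :
    y ∈ annihilator (diasRel K γ) := by
  intro r hr
  have key : (pairing K (Gen γ)).flip y = Finsupp.linearCombination K F ∘ₗ
      Finsupp.lmapDomain K K fun t : STree (Gen γ) 3 => evalWord t.1 := by
    ext t
    simp [pairing_single, hF]
  have hr' := LinearMap.congr_fun key r
  rw [LinearMap.comp_apply, LinearMap.mem_ker.mp hr, map_zero] at hr'
  exact hr'

theorem sign_mul_eq_of_mem_annihilator {y : Free K (Gen γ) 3}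
    (hy : y ∈ annihilator (diasRel K γ)) {s t : STree (Gen γ) 3}
    (hst : evalWord s.1 = evalWord t.1) :
    ((sign s.1 : ℤ) : K) * y s = ((sign t.1 : ℤ) : K) * y t := by
  have h : pairing K (Gen γ) (Finsupp.single s 1 - Finsupp.single t 1) y = 0 := hy _ (by
    rw [diasRel, LinearMap.mem_ker, map_sub, Finsupp.lmapDomain_apply, Finsupp.lmapDomain_apply,
      Finsupp.mapDomain_single, Finsupp.mapDomain_single, hst, sub_self])
  rw [map_sub, LinearMap.sub_apply, pairing_single, pairing_single, one_mul,
    one_mul] at h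
  exact sub_eq_zero.mp h

/-- With the signs of the scalar product, the coefficients of the associator of `x` no longer
distinguish `g ∘₁ h` from `g ∘₂ h`. -/
theorem sign_mul_associator (x : Free K (Gen γ) 2) (g h : Gen γ) :
    ((sign (STree.leftComb g h).1 : ℤ) : K) * Free.associator x (.leftComb g h) =
        x (.corolla g) * x (.corolla h) ∧
      ((sign (STree.rightComb g h).1 : ℤ) : K) * Free.associator x (.rightComb g h) =
        x (.corolla g) * x (.corolla h) := by
  rw [Free.associator_leftComb, Free.associator_rightComb]
  simp [sign, STree.leftComb, STree.rightComb]

/-- The index `a` of the generators `↼_a` and `⇀_a`. -/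
def Gen.index : Gen γ → Idx γ
  | .lft a => a
  | .rgt a => a

theorem precOp_add_succOp_corolla (b : Idx γ) (g : Gen γ) :
    (precOp K b + succOp K b) (.corolla g) = if g.index ≤ b then 1 else 0 := by
  classical
  have hgen (g h : Gen γ) : (Free.gen K g) (.corolla h) = if g = h then 1 else 0 := by
    change (Finsupp.single (STree.corolla g) 1 : Free K (Gen γ) 2) _ = _
    simp only [Finsupp.single_apply, STree.corolla_inj]
  rw [precOp, succOp, Finsupp.add_apply, Finsupp.finsetSum_apply, Finsupp.finsetSum_apply]
  cases g <;> simp [hgen, Gen.index, Finset.sum_ite_eq'] <;> congr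

theorem evalWord_leftComb (g h : Gen γ) :
    evalWord (STree.leftComb g h).1 =
      [max g.word.1 h.word.1, max g.word.1 h.word.2, g.word.2] := by
  simp [STree.leftComb, evalWord]

theorem evalWord_rightComb (g h : Gen γ) :
    evalWord (STree.rightComb g h).1 =
      [g.word.1, max g.word.2 h.word.1, max g.word.2 h.word.2] := by
  simp [STree.rightComb, evalWord]

theorem Gen.word_le_iff (g : Gen γ) (b : Idx γ) :
    g.index ≤ b ↔ g.word.1 ≤ b.1 ∧ g.word.2 ≤ b.1 := by
  cases g <;> simp [Gen.index, Gen.word]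

/-! ### Associative elements of `Dendr_γ` -/

theorem odot_isAssociative (b : Idx γ) : IsAssociative (odot K b) := by
  classical
  rw [odot, dendrProj, isAssociative_proj_iff]
  apply mem_annihilator_of_factors fun w => if ∀ l ∈ w, l ≤ b.1 then 1 else 0
  -- A word has all letters at most `b` exactly when both labels of the tree have index at most `b`.
  intro t
  obtain ⟨g, h, rfl | rfl⟩ := t.eq_leftComb_or_rightComb
  · rw [(sign_mul_associator _ g h).1, precOp_add_succOp_corolla, precOp_add_succOp_corolla,
      ite_zero_mul_ite_zero, mul_one, evalWord_leftComb]
    apply if_congr _ rfl rfl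
    simp only [Gen.word_le_iff, List.forall_mem_cons, max_le_iff, List.not_mem_nil,
      false_imp_iff, implies_true]
    tauto
  · rw [(sign_mul_associator _ g h).2, precOp_add_succOp_corolla, precOp_add_succOp_corolla,
      ite_zero_mul_ite_zero, mul_one, evalWord_rightComb]
    apply if_congr _ rfl rfl
    simp only [Gen.word_le_iff, List.forall_mem_cons, max_le_iff, List.not_mem_nil,
      false_imp_iff, implies_true]
    tauto

/-- A nonzero coefficient of an associative element propagates to all generators of smaller or equal
index, of both kinds. -/
theorem coeff_eq_of_coeff_ne_zero {x : Free K (Gen γ) 2}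
    (hx : Free.associator x ∈ annihilator (diasRel K γ)) {g h : Gen γ}
    (hg : x (.corolla g) ≠ 0) (hgh : h.index ≤ g.index) :
    x (.corolla h) = x (.corolla g) := by
  apply mul_left_cancel₀ hg
  have hle := (Gen.word_le_iff h g.index).mp hgh
  cases g with
  | lft a =>
    -- The trees `↼_a ∘₂ h` and `↼_a ∘₁ ↼_a` both have the word `0aa`.
    rw [← (sign_mul_associator x _ h).2, ← (sign_mul_associator x _ _).1]
    apply sign_mul_eq_of_mem_annihilator hx
    rw [evalWord_leftComb, evalWord_rightComb]
    simpa [Gen.word, Gen.index] using hle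
  | rgt a =>
    -- The trees `⇀_a ∘₁ h` and `⇀_a ∘₂ ⇀_a` both have the word `aa0`.
    rw [← (sign_mul_associator x _ h).1, ← (sign_mul_associator x _ _).2]
    apply sign_mul_eq_of_mem_annihilator hx
    rw [evalWord_leftComb, evalWord_rightComb]
    simpa [Gen.word, Gen.index] using hle

theorem eq_smul_of_associator_mem {x : Free K (Gen γ) 2}
    (hx : Free.associator x ∈ annihilator (diasRel K γ)) (hx0 : x ≠ 0) :
    ∃ (b : Idx γ) (c : K), x = c • (precOp K b + succOp K b) := by
  have hne : {a : Idx γ | ∃ g : Gen γ, g.index = a ∧ x (.corolla g) ≠ 0}.Nonempty := by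
    obtain ⟨t, ht⟩ := Finsupp.ne_iff.mp hx0
    obtain ⟨g, rfl⟩ := t.eq_corolla
    exact ⟨g.index, g, rfl, ht⟩
  obtain ⟨b, ⟨g, rfl, hg⟩, hmax⟩ := Set.exists_max_image _ id (Set.toFinite _) hne
  refine ⟨g.index, x (.corolla g), Finsupp.ext fun t => ?_⟩
  obtain ⟨h, rfl⟩ := t.eq_corolla
  rw [Finsupp.smul_apply, precOp_add_succOp_corolla, smul_eq_mul, mul_ite, mul_one, mul_zero]
  split_ifs with hgh
  · exact coeff_eq_of_coeff_ne_zero hx hg hgh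
  · by_contra hh
    exact hgh (hmax h.index ⟨h, rfl, hh⟩)

end Dias

end PolyDendr

theorem mainTheorem4 (K : Type*) [Field K] [CharZero K] (γ : ℕ) :
    (∀ b : PolyDendr.Idx γ,
      PolyDendr.odot K b =
          PolyDendr.dendrProj K γ 2 (∑ a : PolyDendr.Idx γ with a ≤ b,
            (PolyDendr.Free.gen K (PolyDendr.Gen.lft a) +
              PolyDendr.Free.gen K (PolyDendr.Gen.rgt a))) ∧
        PolyDendr.IsAssociative (PolyDendr.odot K b)) ∧
    (∀ x : PolyDendr.Dendr K γ 2, PolyDendr.IsAssociative x → 1 ≤ γ ∨ x ≠ 0 →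
      ∃ (b : PolyDendr.Idx γ) (c : K), x = c • PolyDendr.odot K b) := by
  refine ⟨fun b => ⟨?_, PolyDendr.odot_isAssociative b⟩, fun x hx hγ => ?_⟩
  · rw [Finset.sum_add_distrib]
    rfl
  · -- `x = 0` is `0 • ⊙_1` when `γ ≥ 1`; for `γ = 0` there is no `⊙_b` at all.
    obtain ⟨X, rfl⟩ := Submodule.Quotient.mk_surjective _ x
    obtain rfl | hX := eq_or_ne X 0
    · obtain hγ | hγ := hγ
      · exact ⟨⟨1, Finset.mem_Icc.mpr ⟨le_rfl, hγ⟩⟩, 0, (zero_smul _ _).symm⟩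
      · exact absurd rfl hγ
    · obtain ⟨b, c, h⟩ := PolyDendr.eq_smul_of_associator_mem
        ((PolyDendr.isAssociative_proj_iff X).mp hx) hX
      refine ⟨b, c, ?_⟩
      rw [PolyDendr.odot, ← map_smul, ← h]
      rfl
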